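/- Let $X$ be a compact metric space with metric $d$ and more than one point, and let $T\colon X\to X$ be a continuous map. Assume that (i) $(X,T)$ is transitive: for any two nonempty open sets $U,V\subset X$ there is an integer $n>0$ with $T^n(U)\cap V\neq\emptyset$; and (ii) $(X,T)$ has the shadowing property: for every $\varepsilon>0$ there is $\delta>0$ such that for every sequence $(x_n)_{n\ge 0}$ in $X$ with $d(T(x_n),x_{n+1})<\delta$ for all $n\ge 0$ there is a point $y\in X$ with $d(T^n(y),x_n)<\varepsilon$ for all $n\ge 0$. Let $M_T(X)$ be the space of $T$-invariant Borel probability measures on $X$ with the weak$^*$ topology. Call $\mu\in M_T(X)$ strongly mixing if $\lim_{n\to\infty}\mu(A\cap T^{-n}(B))=\mu(A)\mu(B)$ for all Borel sets $A,B\subset X$. Then the set of strongly mixing measures is of first category in $M_T(X)$, that is, it is a countable union of nowhere dense subsets of $M_T(X)$. -/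

import Mathlib

open Set Filter Topology MeasureTheory

namespace TopDyn

/-- `(X, T)` is (topologically) transitive: for any two nonempty open sets `U, V` there is `n > 0`
such that `T^n(U)` meets `V`. -/
def IsTransitive {X : Type*} [TopologicalSpace X] (T : X → X) : Prop :=
  ∀ U V : Set X, IsOpen U → U.Nonempty → IsOpen V → V.Nonempty →
    ∃ n : ℕ, 0 < n ∧ (T^[n] '' U ∩ V).Nonempty

/-- `x` is a `δ`-pseudo-orbit of `T`. -/
def IsPseudoOrbit {X : Type*} [MetricSpace X] (T : X → X) (δ : ℝ) (x : ℕ → X) : Prop :=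
  ∀ n : ℕ, dist (T (x n)) (x (n + 1)) < δ

/-- The sequence `x` is `ε`-traced by the point `y`. -/
def IsTracedBy {X : Type*} [MetricSpace X] (T : X → X) (ε : ℝ) (x : ℕ → X) (y : X) : Prop :=
  ∀ n : ℕ, dist (T^[n] y) (x n) < ε

/-- The shadowing property: for every `ε > 0` there is `δ > 0` such that every `δ`-pseudo-orbit is
`ε`-traced by some point. -/
def HasShadowing {X : Type*} [MetricSpace X] (T : X → X) : Prop :=
  ∀ ε : ℝ, 0 < ε → ∃ δ : ℝ, 0 < δ ∧
    ∀ x : ℕ → X, IsPseudoOrbit T δ x → ∃ y : X, IsTracedBy T ε x y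

/-- `M_T(X)`: the `T`-invariant Borel probability measures on `X`. As a subtype of
`ProbabilityMeasure X` it carries the topology of weak convergence of measures (the weak-*
topology). -/
def invariantMeasures {X : Type*} [MeasurableSpace X] (T : X → X) : Set (ProbabilityMeasure X) :=
  {μ | MeasurePreserving T (μ : Measure X) (μ : Measure X)}

/-- `μ` is a strongly mixing measure for `T`: it is invariant and
`μ(A ∩ T^{-n}(B)) → μ(A) μ(B)` for all measurable sets `A`, `B`. -/
structure IsStronglyMixing {X : Type*} [MeasurableSpace X] (T : X → X) (μ : Measure X) : Prop where
  measurePreserving : MeasurePreserving T μ μ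
  tendsto_inter : ∀ A B : Set X, MeasurableSet A → MeasurableSet B →
    Tendsto (fun n : ℕ => μ (A ∩ T^[n] ⁻¹' B)) atTop (𝓝 (μ A * μ B))

end TopDyn

/-! If a strongly mixing measure is not a Dirac measure, some `f = dist · (a i)` with `a` a dense
sequence has positive variance, while the covariances of `f` and `f ∘ T^[k]` tend to 0. So the
strongly mixing measures lie in the union of the Dirac measures and countably many sets where, for
some `i`, `m`, `N` and `c = 1 / (m + 1)`, the variance is at least `2c` and all covariances from
time `N` on are at most `c`.

Both inequalities are closed conditions. If one of these sets were dense in an open set, that open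
set would contain a strongly mixing `μ` of the set. Shadowing closes up a long recurrent `μ`-typical
orbit segment, and a limit of empirical measures along the tracing orbit is an invariant `ν` near
`μ` for which some `T^[n]`, `n ≥ N`, is almost the identity (`exists_almost_rigid`). Its covariance
at time `n` is then almost its variance, a contradiction.

Transitivity enters through the Dirac measures: it yields an invariant measure without mass at a
given fixed point, used to perturb the Dirac measure there (`isNowhereDense_dirac`). -/

namespace TopDyn

/-! ### Invariant measures on orbit closures. -/

variable {X : Type*} [MetricSpace X] [MeasurableSpace X] [BorelSpace X]

/-- The uniform measure on the first `n + 1` points of the orbit of `y`. -/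
noncomputable def empiricalMeasure (T : X → X) (y : X) (n : ℕ) : ProbabilityMeasure X :=
  ⟨((n + 1 : ℕ) : ENNReal)⁻¹ • ∑ i ∈ Finset.range (n + 1), Measure.dirac (T^[i] y), ⟨by
    simp [ENNReal.inv_mul_cancel]⟩⟩

theorem integral_empiricalMeasure [CompactSpace X] (T : X → X) (y : X) (n : ℕ) {g : X → ℝ} (hg : Continuous g) :
    ∫ x, g x ∂(empiricalMeasure T y n : Measure X) = birkhoffAverage ℝ T g (n + 1) y := by
  have hi : ∀ i ∈ Finset.range (n + 1), Integrable g (Measure.dirac (T^[i] y)) := fun i _ =>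
    hg.integrable_of_hasCompactSupport (HasCompactSupport.of_compactSpace g)
  simp only [empiricalMeasure, ProbabilityMeasure.coe_mk, integral_smul_measure,
    integral_finsetSum_measure hi, birkhoffAverage, birkhoffSum, integral_dirac]
  rw [ENNReal.toReal_inv, ENNReal.toReal_natCast]

theorem empiricalMeasure_eq_one (T : X → X) (y : X) (n : ℕ) {C : Set X} (hC : IsClosed C)
    (hy : ∀ i, T^[i] y ∈ C) : (empiricalMeasure T y n : Measure X) C = 1 := by
  simp [empiricalMeasure, hC.measurableSet, hy, ENNReal.inv_mul_cancel]

theorem measurePreserving_of_integral_comp_eq {T : X → X} (hT : Continuous T) (ν : Measure X)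
    [IsFiniteMeasure ν] (h : ∀ g : X → ℝ, Continuous g → ∫ x, g (T x) ∂ν = ∫ x, g x ∂ν) :
    MeasurePreserving T ν ν := by
  refine ⟨hT.measurable, ?_⟩
  have := Measure.isFiniteMeasure_map ν T
  refine ext_of_forall_integral_eq_of_IsFiniteMeasure fun f => ?_
  rw [integral_map hT.aemeasurable f.continuous.aestronglyMeasurable]
  exact h f f.continuous

/-- Every orbit closure of a continuous self-map of a compact space carries an invariant
probability measure. -/
theorem exists_invariant_of_orbit [CompactSpace X] {T : X → X} (hT : Continuous T) (y : X) :
    ∃ ν : ProbabilityMeasure X, ν ∈ invariantMeasures T ∧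
      ∀ C : Set X, IsClosed C → (∀ i, T^[i] y ∈ C) → (ν : Measure X) C = 1 := by
  let 𝒰 : Ultrafilter ℕ := hyperfilter ℕ
  obtain ⟨ν, -, hν⟩ := isCompact_univ.ultrafilter_le_nhds (𝒰.map (empiricalMeasure T y))
    (by simp)
  have hlim : Tendsto (empiricalMeasure T y) 𝒰 (𝓝 ν) := hν
  have hle : (𝒰 : Filter ℕ) ≤ atTop := Nat.hyperfilter_le_atTop
  refine ⟨ν, ?_, fun C hC hy => ?_⟩
  · refine measurePreserving_of_integral_comp_eq hT _ fun g hg => ?_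
    have hA : ∀ g : X → ℝ, Continuous g → Tendsto (fun n => birkhoffAverage ℝ T g (n + 1) y) 𝒰
        (𝓝 (∫ x, g x ∂(ν : Measure X))) := by
      intro g hg
      have := ProbabilityMeasure.tendsto_iff_forall_integral_tendsto.1 hlim
        (BoundedContinuousFunction.mkOfCompact ⟨g, hg⟩)
      refine this.congr fun n => ?_
      exact integral_empiricalMeasure T y n hg
    have hb : Bornology.IsBounded (range (g <| T^[·] y)) :=
      (isCompact_range hg).isBounded.subset (by rintro _ ⟨n, rfl⟩; exact ⟨_, rfl⟩)
    -- The averages at `T y` and at `y` differ by two boundary terms divided by the length.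
    have h0 := (tendsto_birkhoffAverage_apply_sub_birkhoffAverage ℝ hb).comp (tendsto_add_atTop_nat 1)
    have h1 := ((hA _ (hg.comp hT)).sub (hA _ hg))
    have h2 := tendsto_nhds_unique (h1.congr fun n => ?_) (h0.mono_left hle)
    · exact sub_eq_zero.1 h2
    · have hc : birkhoffAverage ℝ T (g ∘ T) (n + 1) y =
          birkhoffAverage ℝ T g (n + 1) (T y) := by
        simp only [birkhoffAverage, birkhoffSum, Function.comp_apply, ← Function.iterate_succ_apply,
          ← Function.iterate_succ_apply' T]
      rw [hc]
      rfl
  · refine le_antisymm prob_le_one ?_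
    have := ProbabilityMeasure.limsup_measure_closed_le_of_tendsto hlim hC
    simpa [empiricalMeasure_eq_one T y _ hC hy] using this

/-! ### Decay of correlations for bounded functions. -/

section Mixing

variable {X : Type*} [MeasurableSpace X] {T : X → X} {μ : Measure X} [IsProbabilityMeasure μ]

theorem IsStronglyMixing.tendsto_integral_simpleFunc (h : IsStronglyMixing T μ)
    (s : SimpleFunc X ℝ) :
    Tendsto (fun k : ℕ => ∫ x, s x * s (T^[k] x) ∂μ) atTop (𝓝 ((∫ x, s x ∂μ) ^ 2)) := by
  have hm : ∀ k, Measurable T^[k] := fun k => h.measurePreserving.measurable.iterate k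
  have hs : ∀ x, s x = ∑ a ∈ s.range, (s ⁻¹' {a}).indicator (fun _ => a) x := by
    intro x
    rw [Finset.sum_eq_single (s x)]
    · simp
    · intro b _ hb
      simp [hb.symm]
    · simp
  have hms : ∀ a, MeasurableSet (s ⁻¹' {a}) := fun a => s.measurableSet_fiber a
  have e1 : ∫ x, s x ∂μ = ∑ a ∈ s.range, a * μ.real (s ⁻¹' {a}) := by
    rw [← SimpleFunc.integral_eq_integral _ (SimpleFunc.integrable_of_isFiniteMeasure s)]
    simp [SimpleFunc.integral_eq, mul_comm]
  have e2 : ∀ k : ℕ, ∫ x, s x * s (T^[k] x) ∂μ =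
      ∑ a ∈ s.range, ∑ b ∈ s.range, a * b * μ.real (s ⁻¹' {a} ∩ T^[k] ⁻¹' (s ⁻¹' {b})) := by
    intro k
    have hpt : ∀ x, s x * s (T^[k] x) = ∑ a ∈ s.range, ∑ b ∈ s.range,
        (s ⁻¹' {a} ∩ T^[k] ⁻¹' (s ⁻¹' {b})).indicator (fun _ => a * b) x := by
      intro x
      rw [hs x, hs (T^[k] x), Finset.sum_mul_sum]
      refine Finset.sum_congr rfl fun a _ => Finset.sum_congr rfl fun b _ => ?_
      by_cases h1 : s x = a <;> by_cases h2 : s (T^[k] x) = b <;> simp [h1, h2, indicator]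
    have hmm : ∀ a b, MeasurableSet (s ⁻¹' {a} ∩ T^[k] ⁻¹' (s ⁻¹' {b})) := fun a b =>
      (hms a).inter (hm k (hms b))
    have hint : ∀ a b, Integrable
        ((s ⁻¹' {a} ∩ T^[k] ⁻¹' (s ⁻¹' {b})).indicator (fun _ => a * b)) μ := fun a b =>
      (integrable_const _).indicator (hmm a b)
    simp_rw [hpt]
    rw [integral_finsetSum _ fun a _ => integrable_finsetSum _ fun b _ => hint a b]
    refine Finset.sum_congr rfl fun a _ => ?_
    rw [integral_finsetSum _ fun b _ => hint a b]
    refine Finset.sum_congr rfl fun b _ => ?_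
    rw [integral_indicator_const _ (hmm a b), smul_eq_mul, mul_comm]
  simp_rw [e2]
  rw [e1, sq, Finset.sum_mul_sum]
  refine tendsto_finsetSum _ fun a _ => tendsto_finsetSum _ fun b _ => ?_
  have := (ENNReal.tendsto_toReal (by finiteness)).comp
    (h.tendsto_inter _ _ (hms a) (hms b))
  rw [ENNReal.toReal_mul] at this
  have hab := this.const_mul (a * b)
  rw [mul_mul_mul_comm] at hab
  exact hab

/-- Round `f` down to the grid of mesh `ε`; boundedness leaves finitely many values. -/
theorem exists_simpleFunc_abs_sub_le {f : X → ℝ} (hf : Measurable f) {C : ℝ}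
    (hC : ∀ x, |f x| ≤ C) {ε : ℝ} (hε : 0 < ε) :
    ∃ s : SimpleFunc X ℝ, ∀ x, |f x - s x| ≤ ε := by
  have hm : Measurable fun x => (⌊f x / ε⌋ : ℤ) := (hf.div_const ε).floor
  have hfin : (range fun x => (⌊f x / ε⌋ : ℤ)).Finite := by
    refine (finite_Icc ⌊-C / ε⌋ ⌊C / ε⌋).subset ?_
    rintro _ ⟨x, rfl⟩
    have := abs_le.1 (hC x)
    exact ⟨Int.floor_mono (by gcongr; exact this.1), Int.floor_mono (by gcongr; exact this.2)⟩
  let s₀ : SimpleFunc X ℤ := ⟨_, fun a => hm (measurableSet_singleton a), hfin⟩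
  refine ⟨s₀.map fun n : ℤ => ε * (n : ℝ), fun x => ?_⟩
  have h1 := Int.floor_le (f x / ε)
  have h2 := Int.lt_floor_add_one (f x / ε)
  rw [le_div_iff₀ hε] at h1
  rw [div_lt_iff₀ hε] at h2
  change |f x - ε * ⌊f x / ε⌋| ≤ ε
  rw [abs_le]
  constructor <;> nlinarith

/-- Uniform approximation by a simple function changes every correlation by an amount independent of
`k`. -/
theorem IsStronglyMixing.tendsto_integral (h : IsStronglyMixing T μ) {f : X → ℝ}
    (hf : Measurable f) {C : ℝ} (hC : ∀ x, |f x| ≤ C) :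
    Tendsto (fun k : ℕ => ∫ x, f x * f (T^[k] x) ∂μ) atTop (𝓝 ((∫ x, f x ∂μ) ^ 2)) := by
  have hm : ∀ k, Measurable T^[k] := fun k => h.measurePreserving.measurable.iterate k
  have hC0 : 0 ≤ C := by
    obtain ⟨x⟩ := nonempty_of_isProbabilityMeasure μ
    exact (abs_nonneg _).trans (hC x)
  rw [Metric.tendsto_atTop]
  intro η hη
  obtain ⟨ε, hε, hε1, hεη⟩ : ∃ ε : ℝ, 0 < ε ∧ ε ≤ 1 ∧ ε * (2 * C + 1) ≤ η / 3 := by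
    refine ⟨min 1 (η / 3 / (2 * C + 1)), by positivity, min_le_left _ _, ?_⟩
    calc _ ≤ (η / 3 / (2 * C + 1)) * (2 * C + 1) := by gcongr; exact min_le_right _ _
      _ = _ := by field_simp
  obtain ⟨s, hs⟩ := exists_simpleFunc_abs_sub_le hf hC hε
  have hsC : ∀ x, |s x| ≤ C + 1 := fun x => by
    have h1 := abs_le.1 (hs x); have h2 := abs_le.1 (hC x)
    rw [abs_le]; constructor <;> linarith
  have key : ∀ a b a' b' : ℝ, |a| ≤ C → |b'| ≤ C + 1 → |a - b| ≤ ε → |a' - b'| ≤ ε →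
      |a * a' - b * b'| ≤ η / 3 := by
    intro a b a' b' h1 h2 h3 h4
    calc |a * a' - b * b'| = |a * (a' - b') + (a - b) * b'| := by ring_nf
      _ ≤ |a| * |a' - b'| + |a - b| * |b'| := by
        rw [← abs_mul, ← abs_mul]; exact abs_add_le _ _
      _ ≤ C * ε + ε * (C + 1) := by gcongr
      _ ≤ η / 3 := by linarith
  have hfi : Integrable f μ := .of_bound hf.aestronglyMeasurable C (.of_forall hC)
  have hsi : Integrable s μ := SimpleFunc.integrable_of_isFiniteMeasure s
  have hmean : |(∫ x, f x ∂μ) - ∫ x, s x ∂μ| ≤ ε := by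
    rw [← integral_sub hfi hsi]
    simpa using norm_integral_le_of_norm_le_const (μ := μ) (f := fun x => f x - s x) (.of_forall hs)
  have hb1 : |∫ x, f x ∂μ| ≤ C := by
    simpa using norm_integral_le_of_norm_le_const (μ := μ) (f := f) (.of_forall hC)
  have hb2 : |∫ x, s x ∂μ| ≤ C + 1 := by
    simpa using norm_integral_le_of_norm_le_const (μ := μ) (f := s) (.of_forall hsC)
  have hlim : |(∫ x, f x ∂μ) ^ 2 - (∫ x, s x ∂μ) ^ 2| ≤ η / 3 := by
    rw [sq, sq]; exact key _ _ _ _ hb1 hb2 hmean hmean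
  have hcor : ∀ k : ℕ, |(∫ x, f x * f (T^[k] x) ∂μ) - ∫ x, s x * s (T^[k] x) ∂μ| ≤ η / 3 := by
    intro k
    rw [← integral_sub]
    · simpa using norm_integral_le_of_norm_le_const (μ := μ)
        (f := fun x => f x * f (T^[k] x) - s x * s (T^[k] x)) (C := η / 3)
        (.of_forall fun x => key _ _ _ _ (hC x) (hsC _) (hs _) (hs _))
    · refine .of_bound (hf.mul (hf.comp (hm k))).aestronglyMeasurable (C * C) (.of_forall fun x => ?_)
      rw [norm_mul]
      exact mul_le_mul (hC _) (hC _) (norm_nonneg _) hC0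
    · refine .of_bound (s.measurable.mul (s.measurable.comp (hm k))).aestronglyMeasurable
        ((C + 1) * (C + 1)) (.of_forall fun x => ?_)
      rw [norm_mul]
      exact mul_le_mul (hsC _) (hsC _) (norm_nonneg _) (by linarith)
  obtain ⟨N, hN⟩ := Metric.tendsto_atTop.1 (h.tendsto_integral_simpleFunc s) (η / 3) (by positivity)
  refine ⟨N, fun n hn => ?_⟩
  have h1 := hN n hn
  rw [Real.dist_eq] at h1 ⊢
  have h2 := abs_le.1 (hcor n)
  have h3 := abs_le.1 hlim
  have h4 := abs_lt.1 h1
  rw [abs_lt]; constructor <;> linarith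

end Mixing

/-! ### Mean ergodic theorem by a variance computation. -/

/-- If `a (n + 1) - a n = o(n)` then `a n = o(n ^ 2)`. -/
theorem tendsto_div_sq_of_tendsto_diff {a : ℕ → ℝ} (h0 : a 0 = 0)
    (h : Tendsto (fun n : ℕ => (a (n + 1) - a n) / (n + 1)) atTop (𝓝 0)) :
    Tendsto (fun n : ℕ => a n / (n : ℝ) ^ 2) atTop (𝓝 0) := by
  have h1 := h.abs
  rw [abs_zero] at h1
  have h2 := h1.cesaro
  refine squeeze_zero_norm (fun n => ?_) h2
  have e : a n = ∑ m ∈ Finset.range n, (a (m + 1) - a m) := by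
    rw [Finset.sum_range_sub, h0, sub_zero]
  have hle : |a n| ≤ n * ∑ m ∈ Finset.range n, |(a (m + 1) - a m) / (m + 1)| := by
    rw [e, Finset.mul_sum]
    refine (Finset.abs_sum_le_sum_abs _ _).trans (Finset.sum_le_sum fun m hm => ?_)
    have hmn : (m : ℝ) + 1 ≤ n := by exact_mod_cast Finset.mem_range.1 hm
    have hm0 : (0 : ℝ) < m + 1 := by positivity
    rw [abs_div, abs_of_pos hm0, mul_div_assoc', le_div_iff₀ hm0, mul_comm (n : ℝ)]
    gcongr
  rcases n.eq_zero_or_pos with rfl | hn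
  · simp
  have hn' : (0 : ℝ) < n := by exact_mod_cast hn
  rw [Real.norm_eq_abs, abs_div, abs_of_pos (by positivity : (0 : ℝ) < (n : ℝ) ^ 2),
    div_le_iff₀ (by positivity)]
  refine hle.trans (le_of_eq ?_)
  field_simp

section MeanErgodic

variable {X : Type*} [MetricSpace X] {T : X → X}

theorem integrable_of_continuous [CompactSpace X] [MeasurableSpace X] [BorelSpace X] (μ : Measure X) [IsFiniteMeasure μ] {g : X → ℝ}
    (hg : Continuous g) : Integrable g μ :=
  hg.integrable_of_hasCompactSupport (HasCompactSupport.of_compactSpace g)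

theorem exists_abs_le_of_continuous [CompactSpace X] {g : X → ℝ} (hg : Continuous g) : ∃ C, ∀ x, |g x| ≤ C := by
  obtain ⟨C, hC⟩ := isCompact_univ.exists_bound_of_continuousOn hg.continuousOn
  exact ⟨C, fun x => hC x (mem_univ x)⟩

theorem IsStronglyMixing.tendsto_integral_of_continuous [CompactSpace X] [MeasurableSpace X]
    [BorelSpace X] {μ : Measure X} [IsProbabilityMeasure μ]
    (h : IsStronglyMixing T μ) {f : X → ℝ} (hf : Continuous f) :
    Tendsto (fun k : ℕ => ∫ x, f x * f (T^[k] x) ∂μ) atTop (𝓝 ((∫ x, f x ∂μ) ^ 2)) := by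
  obtain ⟨C, hC⟩ := exists_abs_le_of_continuous hf
  exact h.tendsto_integral hf.measurable hC

theorem continuous_birkhoffSum (hT : Continuous T) {g : X → ℝ} (hg : Continuous g) (n : ℕ) :
    Continuous (birkhoffSum T g n) := by
  unfold birkhoffSum
  exact continuous_finsetSum _ fun i _ => hg.comp (hT.iterate i)

theorem continuous_birkhoffAverage (hT : Continuous T) {g : X → ℝ} (hg : Continuous g) (n : ℕ) :
    Continuous (birkhoffAverage ℝ T g n) :=
  (continuous_birkhoffSum hT hg n).const_smul (n : ℝ)⁻¹

/-- The mean ergodic theorem for strongly mixing measures. -/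
theorem IsStronglyMixing.tendsto_integral_birkhoffAverage [CompactSpace X] [MeasurableSpace X]
    [BorelSpace X] {μ : Measure X} [IsProbabilityMeasure μ]
    (h : IsStronglyMixing T μ) (hT : Continuous T) {f : X → ℝ} (hf : Continuous f) :
    Tendsto (fun n : ℕ => ∫ x, (birkhoffAverage ℝ T f n x - ∫ z, f z ∂μ) ^ 2 ∂μ) atTop (𝓝 0) := by
  set c := ∫ z, f z ∂μ with hc
  let g : X → ℝ := fun x => f x - c
  have hg : Continuous g := hf.sub continuous_const
  have hg0 : ∫ x, g x ∂μ = 0 := by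
    simp only [g]
    rw [integral_sub (integrable_of_continuous μ hf) (integrable_const _)]
    simp [hc]
  have hcor := h.tendsto_integral_of_continuous hg
  rw [hg0, sq, mul_zero] at hcor
  let a : ℕ → ℝ := fun n => ∫ x, (birkhoffSum T g n x) ^ 2 ∂μ
  let r : ℕ → ℝ := fun k => ∫ x, g x * g (T^[k] x) ∂μ
  -- Square `S (n + 1) = g + S n ∘ T` and integrate, using invariance.
  have hdiff : ∀ n, a (n + 1) - a n = 2 * ∑ i ∈ Finset.range (n + 1), r i - r 0 := by
    intro n
    have hS := continuous_birkhoffSum hT hg n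
    have e1 : ∫ x, (birkhoffSum T g n (T x)) ^ 2 ∂μ = a n := by
      have := integral_map (μ := μ) hT.aemeasurable (f := fun x => (birkhoffSum T g n x) ^ 2)
        (hS.pow 2).aestronglyMeasurable
      rw [h.measurePreserving.map_eq] at this
      exact this.symm
    have e2 : ∫ x, g x * birkhoffSum T g n (T x) ∂μ = ∑ i ∈ Finset.range n, r (i + 1) := by
      simp only [birkhoffSum, Finset.mul_sum, r, Function.iterate_succ_apply]
      exact integral_finsetSum _ fun i _ => integrable_of_continuous μ
        (hg.mul (hg.comp ((hT.iterate i).comp hT)))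
    have e3 : a (n + 1) = r 0 + 2 * ∫ x, g x * birkhoffSum T g n (T x) ∂μ +
        ∫ x, (birkhoffSum T g n (T x)) ^ 2 ∂μ := by
      have i1 : Integrable (fun x => g x * g x) μ := integrable_of_continuous μ (hg.mul hg)
      have i2 : Integrable (fun x => 2 * (g x * birkhoffSum T g n (T x))) μ :=
        integrable_of_continuous μ (continuous_const.mul (hg.mul (hS.comp hT)))
      have i3 : Integrable (fun x => (birkhoffSum T g n (T x)) ^ 2) μ :=
        integrable_of_continuous μ ((hS.comp hT).pow 2)
      have i12 : Integrable (fun x => g x * g x + 2 * (g x * birkhoffSum T g n (T x))) μ :=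
        i1.add i2
      simp only [r, a, Function.iterate_zero, id]
      rw [← integral_const_mul, ← integral_add i1 i2, ← integral_add i12 i3]
      refine integral_congr_ae (.of_forall fun x => ?_)
      simp only [birkhoffSum_succ']
      ring
    rw [e3, e1, e2, Finset.sum_range_succ' r]
    ring
  have h1 : Tendsto (fun n : ℕ => (a (n + 1) - a n) / (n + 1)) atTop (𝓝 0) := by
    have h2 := (hcor.cesaro).comp (tendsto_add_atTop_nat 1)
    have h3 : Tendsto (fun n : ℕ => r 0 * (1 / ((n : ℝ) + 1))) atTop (𝓝 (r 0 * 0)) :=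
      tendsto_one_div_add_atTop_nhds_zero_nat.const_mul _
    have h4 := (h2.const_mul 2).sub h3
    simp only [mul_zero, sub_zero] at h4
    refine h4.congr fun n => ?_
    rw [hdiff]
    simp only [Function.comp, Nat.cast_add, Nat.cast_one, r]
    field_simp
  have h2 := tendsto_div_sq_of_tendsto_diff (a := a) (by simp [a]) h1
  refine h2.congr' ?_
  filter_upwards [eventually_gt_atTop 0] with n hn
  have hn' : (n : ℝ) ≠ 0 := by exact_mod_cast hn.ne'
  rw [← integral_div]
  refine integral_congr_ae (.of_forall fun x => ?_)
  have : birkhoffSum T g n x = birkhoffSum T f n x - n * c := by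
    simp [birkhoffSum, g, Finset.sum_sub_distrib]
  simp only [this, birkhoffAverage, smul_eq_mul]
  field_simp

end MeanErgodic

/-! ### Closing orbit segments by shadowing. -/

theorem sum_range_add_eq_of_periodic {u : ℕ → ℝ} {n : ℕ} (hu : ∀ i, u (i + n) = u i) (j : ℕ) :
    ∑ i ∈ Finset.range n, u (i + j) = ∑ i ∈ Finset.range n, u i := by
  induction j with
  | zero => rfl
  | succ j ih =>
    rw [← ih]
    have h1 := Finset.sum_range_succ (fun i => u (i + j)) n
    have h2 := Finset.sum_range_succ' (fun i => u (i + j)) n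
    have h3 : u (n + j) = u (0 + j) := by rw [add_comm n, hu, zero_add]
    have h4 : ∀ i, u (i + 1 + j) = u (i + (j + 1)) := fun i => by congr 1; ring
    simp only [h4] at h2
    linarith

section Shadowing

variable {X : Type*} [MetricSpace X] {T : X → X}

/-- Under shadowing, an almost closed orbit segment, repeated periodically, is traced. -/
theorem HasShadowing.exists_closing (h : HasShadowing T) {ε : ℝ} (hε : 0 < ε) :
    ∃ δ : ℝ, 0 < δ ∧ ∀ (x : X) (n : ℕ), 0 < n → dist (T^[n] x) x < δ →
      ∃ y : X, ∀ j, dist (T^[j] y) (T^[j % n] x) < ε := by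
  obtain ⟨δ, hδ, H⟩ := h ε hε
  refine ⟨δ, hδ, fun x n hn hx => H (fun j => T^[j % n] x) fun j => ?_⟩
  simp only [← Function.iterate_succ_apply' T]
  -- The pseudo-orbit jumps only where it wraps from `T^[n - 1] x` to `x`.
  rcases Nat.lt_or_ge (j % n + 1) n with hj | hj
  · have : (j + 1) % n = j % n + 1 := by
      rw [Nat.add_mod, Nat.mod_eq_of_lt (show 1 < n by omega), Nat.mod_eq_of_lt hj]
    rw [this, dist_self]
    exact hδ
  · have hlt := Nat.mod_lt j hn
    have hjn : j % n + 1 = n := by omega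
    have : (j + 1) % n = 0 := by rw [← Nat.mod_add_mod, hjn, Nat.mod_self]
    rw [Nat.succ_eq_add_one, hjn, this]
    exact hx

/-- Any `n` consecutive times run once through the cycle of residues, so the bound is uniform in `j`
and extends to the orbit closure of `y`. -/
theorem abs_birkhoffAverage_sub_le_of_traced {x y : X} {n : ℕ} (hn : 0 < n) {ε η : ℝ}
    (hy : ∀ j, dist (T^[j] y) (T^[j % n] x) < ε) {g : X → ℝ}
    (hg : ∀ a b, dist a b < ε → |g a - g b| ≤ η) (j : ℕ) :
    |birkhoffAverage ℝ T g n (T^[j] y) - birkhoffAverage ℝ T g n x| ≤ η := by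
  have hn' : (0 : ℝ) < n := by exact_mod_cast hn
  have e : birkhoffSum T g n x = ∑ i ∈ Finset.range n, g (T^[(i + j) % n] x) := by
    rw [sum_range_add_eq_of_periodic (u := fun i => g (T^[i % n] x)) (by simp)]
    refine Finset.sum_congr rfl fun i hi => ?_
    rw [Nat.mod_eq_of_lt (Finset.mem_range.1 hi)]
  have hb : |birkhoffSum T g n (T^[j] y) - birkhoffSum T g n x| ≤ n * η := by
    rw [e, birkhoffSum, ← Finset.sum_sub_distrib]
    refine (Finset.abs_sum_le_sum_abs _ _).trans ?_
    refine (Finset.sum_le_card_nsmul _ _ η fun i _ => ?_).trans (by simp)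
    rw [← Function.iterate_add_apply]
    exact hg _ _ (hy _)
  rw [birkhoffAverage, birkhoffAverage, ← smul_sub, smul_eq_mul, abs_mul,
    abs_of_pos (inv_pos.2 hn'), inv_mul_le_iff₀ hn']
  exact hb

variable [MeasurableSpace X] [BorelSpace X]

theorem ae_mem_of_eq_one {ν : Measure X} [IsProbabilityMeasure ν] {C : Set X} (hC : IsClosed C)
    (h : ν C = 1) : ∀ᵐ z ∂ν, z ∈ C :=
  (prob_compl_eq_zero_iff hC.measurableSet).2 h

variable [CompactSpace X]

theorem integral_birkhoffAverage (hT : Continuous T) {ν : Measure X} [IsProbabilityMeasure ν]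
    (hν : MeasurePreserving T ν ν) {g : X → ℝ} (hg : Continuous g) {n : ℕ} (hn : 0 < n) :
    ∫ z, birkhoffAverage ℝ T g n z ∂ν = ∫ z, g z ∂ν := by
  have hn' : (n : ℝ) ≠ 0 := by exact_mod_cast hn.ne'
  have h : ∀ i, ∫ z, g (T^[i] z) ∂ν = ∫ z, g z ∂ν := fun i => by
    have := integral_map (μ := ν) (hT.iterate i).aemeasurable hg.aestronglyMeasurable
    rw [(hν.iterate i).map_eq] at this
    exact this.symm
  simp only [birkhoffAverage, birkhoffSum]
  rw [integral_smul, integral_finsetSum (f := fun i z => g (T^[i] z)) _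
    fun i _ => integrable_of_continuous ν (hg.comp (hT.iterate i))]
  simp [h, hn']

/-- A traced periodic pseudo-orbit yields an invariant measure which nearly has the same averages
and for which the period is an almost return time. -/
theorem exists_invariant_of_traced (hT : Continuous T) {x y : X} {n : ℕ} (hn : 0 < n) {ε : ℝ}
    (hy : ∀ j, dist (T^[j] y) (T^[j % n] x) < ε) :
    ∃ ν : ProbabilityMeasure X, ν ∈ invariantMeasures T ∧
      (∀ (g : X → ℝ) (η : ℝ), Continuous g → (∀ a b, dist a b < ε → |g a - g b| ≤ η) →
        |∫ z, g z ∂(ν : Measure X) - birkhoffAverage ℝ T g n x| ≤ η) ∧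
      ∀ᵐ z ∂(ν : Measure X), dist (T^[n] z) z ≤ 2 * ε := by
  obtain ⟨ν, hinv, hν⟩ := exists_invariant_of_orbit hT y
  refine ⟨ν, hinv, fun g η hg hmod => ?_, ?_⟩
  · have hcont := continuous_birkhoffAverage hT hg n
    have hC : IsClosed {z | |birkhoffAverage ℝ T g n z - birkhoffAverage ℝ T g n x| ≤ η} :=
      isClosed_le (hcont.sub continuous_const).abs continuous_const
    have hae := ae_mem_of_eq_one hC (hν _ hC (abs_birkhoffAverage_sub_le_of_traced hn hy hmod))
    have := norm_integral_le_of_norm_le_const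
      (f := fun z => birkhoffAverage ℝ T g n z - birkhoffAverage ℝ T g n x) hae
    rw [integral_sub (integrable_of_continuous _ hcont) (integrable_const _),
      integral_birkhoffAverage hT hinv hg hn] at this
    simpa using this
  · have hC : IsClosed {z | dist (T^[n] z) z ≤ 2 * ε} :=
      isClosed_le ((hT.iterate n).dist continuous_id) continuous_const
    refine ae_mem_of_eq_one hC (hν _ hC fun j => ?_)
    -- Times `n + j` and `j` have the same residue, so both orbit points are `ε`-close to the same
    -- point.
    have h1 := hy (n + j)
    have h2 := hy j
    rw [Nat.add_mod_left, Function.iterate_add_apply] at h1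
    have h3 := dist_triangle_right (T^[n] (T^[j] y)) (T^[j] y) (T^[j % n] x)
    change dist (T^[n] (T^[j] y)) (T^[j] y) ≤ 2 * ε
    linarith

/-- For a strongly mixing measure there are arbitrarily long almost closed orbit segments along
which finitely many given continuous functions have almost the right averages. -/
theorem IsStronglyMixing.exists_recurrent_typical {μ : Measure X} [IsProbabilityMeasure μ]
    (h : IsStronglyMixing T μ) (hT : Continuous T) (F : Finset C(X, ℝ)) {η δ : ℝ} (hη : 0 < η)
    (hδ : 0 < δ) (N : ℕ) :
    ∃ n, N ≤ n ∧ ∃ x, dist (T^[n] x) x < δ ∧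
      ∀ g ∈ F, |birkhoffAverage ℝ T g n x - ∫ z, g z ∂μ| ≤ η := by
  obtain ⟨p, hp⟩ := Measure.nonempty_support (IsProbabilityMeasure.ne_zero μ)
  have hA : 0 < μ (Metric.ball p (δ / 2)) :=
    (Measure.mem_support_iff_forall p).1 hp _ (Metric.ball_mem_nhds p (by positivity))
  set A := Metric.ball p (δ / 2) with hAdef
  have hAm : MeasurableSet A := measurableSet_ball
  have hAr : 0 < μ.real A := ENNReal.toReal_pos hA.ne' (by finiteness)
  let q : ℕ → X → ℝ := fun n x => ∑ g ∈ F, (birkhoffAverage ℝ T g n x - ∫ z, g z ∂μ) ^ 2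
  have hqc : ∀ n, Continuous (q n) := fun n => continuous_finsetSum _ fun g _ =>
    ((continuous_birkhoffAverage hT g.continuous n).sub continuous_const).pow 2
  have hq : Tendsto (fun n => ∫ x, q n x ∂μ) atTop (𝓝 0) := by
    have := tendsto_finsetSum F fun g _ => h.tendsto_integral_birkhoffAverage hT g.continuous
    rw [Finset.sum_const_zero] at this
    refine this.congr fun n => ?_
    exact (integral_finsetSum _ fun g _ => integrable_of_continuous μ
      (((continuous_birkhoffAverage hT g.continuous n).sub continuous_const).pow 2)).symm
  have hrec : Tendsto (fun n => η ^ 2 * μ.real (A ∩ T^[n] ⁻¹' A)) atTop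
      (𝓝 (η ^ 2 * (μ.real A * μ.real A))) := by
    have := (ENNReal.tendsto_toReal (by finiteness)).comp (h.tendsto_inter A A hAm hAm)
    rw [ENNReal.toReal_mul] at this
    exact this.const_mul (η ^ 2)
  -- The return set has measure tending to `μ(A)² > 0`, while by Chebyshev the set of atypical
  -- points has measure tending to 0; for large `n` the former is not contained in the latter.
  obtain ⟨n, hn1, hn2⟩ := ((hq.eventually_lt hrec (by positivity)).and
    (eventually_ge_atTop N)).exists
  refine ⟨n, hn2, ?_⟩
  have hex : ∃ x ∈ A ∩ T^[n] ⁻¹' A, q n x < η ^ 2 := by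
    by_contra! hcon
    have h1 := mul_meas_ge_le_integral_of_nonneg (μ := μ) (f := q n)
      (.of_forall fun x => Finset.sum_nonneg fun g _ => sq_nonneg _)
      (integrable_of_continuous μ (hqc n)) (η ^ 2)
    have h2 : μ.real (A ∩ T^[n] ⁻¹' A) ≤ μ.real {x | η ^ 2 ≤ q n x} := measureReal_mono hcon
    nlinarith [sq_nonneg η]
  obtain ⟨x, ⟨hx1, hx2⟩, hx3⟩ := hex
  refine ⟨x, ?_, fun g hg => ?_⟩
  · have h1 : dist x p < δ / 2 := hx1
    have h2 : dist (T^[n] x) p < δ / 2 := hx2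
    linarith [dist_triangle_right (T^[n] x) x p]
  · refine abs_le_of_sq_le_sq (le_trans ?_ hx3.le) hη.le
    exact Finset.single_le_sum
      (f := fun g : C(X, ℝ) => (birkhoffAverage ℝ T g n x - ∫ z, g z ∂μ) ^ 2)
      (fun g _ => sq_nonneg _) hg

/-! ### Almost rigid measures and nowhere density. -/

/-- Near a strongly mixing measure there are invariant measures which are almost rigid. -/
theorem IsStronglyMixing.exists_almost_rigid {μ : Measure X} [IsProbabilityMeasure μ]
    (h : IsStronglyMixing T μ) (hT : Continuous T) (hsh : HasShadowing T) (F : Finset C(X, ℝ))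
    (f : C(X, ℝ)) {η : ℝ} (hη : 0 < η) (N : ℕ) :
    ∃ ν : ProbabilityMeasure X, ν ∈ invariantMeasures T ∧
      (∀ g ∈ F, |∫ z, g z ∂(ν : Measure X) - ∫ z, g z ∂μ| ≤ η) ∧
      ∃ k, N ≤ k ∧ |∫ z, f z * f (T^[k] z) ∂(ν : Measure X) -
        ∫ z, f z * f z ∂(ν : Measure X)| ≤ η := by
  obtain ⟨C, hC⟩ := exists_abs_le_of_continuous f.continuous
  have hC0 : 0 ≤ C := by
    obtain ⟨x⟩ := nonempty_of_isProbabilityMeasure μ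
    exact (abs_nonneg _).trans (hC x)
  have huc : ∀ g : C(X, ℝ), ∀ θ > 0, ∀ᶠ p in uniformity X, |g p.1 - g p.2| ≤ θ := by
    intro g θ hθ
    have hu : UniformContinuous g := CompactSpace.uniformContinuous_of_continuous g.continuous
    obtain ⟨r, hr, hmod⟩ := Metric.uniformContinuous_iff_le.1 hu θ hθ
    filter_upwards [Metric.dist_mem_uniformity hr] with p hp
    exact hmod (le_of_lt hp)
  have hev := ((eventually_all_finset F).2 fun g _ => huc g (η / 2) (by positivity)).and
    (huc f (η / (C + 1)) (by positivity))
  obtain ⟨ε₀, hε₀, hmod⟩ := Metric.mem_uniformity_dist.1 hev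
  -- Tracing at `ε₀ / 3` makes the return distance at most `2ε₀ / 3 < ε₀`. Below, `N + 1` rather
  -- than `N` ensures a positive period.
  obtain ⟨δ, hδ, hclose⟩ := hsh.exists_closing (ε := ε₀ / 3) (by positivity)
  obtain ⟨n, hn, x, hx, hav⟩ := h.exists_recurrent_typical hT F (η := η / 2) (by positivity) hδ
    (N + 1)
  obtain ⟨y, hy⟩ := hclose x n (by omega) hx
  obtain ⟨ν, hinv, hg, hret⟩ := exists_invariant_of_traced hT (by omega) hy
  refine ⟨ν, hinv, fun g hgF => ?_, n, by omega, ?_⟩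
  · have h1 := hg g (η / 2) g.continuous fun a b hab =>
      (hmod (show dist a b < ε₀ by linarith)).1 g hgF
    have h2 := hav g hgF
    calc _ ≤ _ := abs_sub_le _ (birkhoffAverage ℝ T g n x) _
      _ ≤ η := by linarith
  · have i1 : Integrable (fun z => f z * f (T^[n] z)) (ν : Measure X) :=
      integrable_of_continuous _ (f.continuous.mul (f.continuous.comp (hT.iterate n)))
    have i2 : Integrable (fun z => f z * f z) (ν : Measure X) :=
      integrable_of_continuous _ (f.continuous.mul f.continuous)
    rw [← integral_sub i1 i2]
    have hae : ∀ᵐ z ∂(ν : Measure X), ‖f z * f (T^[n] z) - f z * f z‖ ≤ η := by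
      filter_upwards [hret] with z hz
      have h1 := (hmod (show dist (T^[n] z) z < ε₀ by linarith)).2
      rw [← mul_sub, norm_mul]
      calc _ ≤ C * (η / (C + 1)) := mul_le_mul (hC z) h1 (abs_nonneg _) hC0
        _ ≤ (C + 1) * (η / (C + 1)) := by gcongr; linarith
        _ = η := by field_simp
    simpa using norm_integral_le_of_norm_le_const hae

/-- Index the almost rigid measures by a finite set of test functions and a precision; the resulting
net converges weakly to `μ`, so it enters `U`. -/
theorem exists_almost_rigid_mem_of_isOpen (hT : Continuous T) (hsh : HasShadowing T)
    {U : Set (invariantMeasures T)} (hU : IsOpen U) {μ : invariantMeasures T} (hμU : μ ∈ U)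
    (h : IsStronglyMixing T ((μ : ProbabilityMeasure X) : Measure X)) (f : C(X, ℝ)) {η : ℝ}
    (hη : 0 < η) (N : ℕ) :
    ∃ ν ∈ U, ∃ k, N ≤ k ∧ |∫ z, f z * f (T^[k] z) ∂((ν : ProbabilityMeasure X) : Measure X) -
        ∫ z, f z * f z ∂((ν : ProbabilityMeasure X) : Measure X)| ≤ η := by
  classical
  choose ν hinv hclose hrig using fun p : Finset C(X, ℝ) × ℕ =>
    h.exists_almost_rigid hT hsh p.1 f (η := min η (1 / ((p.2 : ℝ) + 1))) (by positivity) N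
  have hlim : Tendsto (fun p => (⟨ν p, hinv p⟩ : invariantMeasures T)) atTop (𝓝 μ) := by
    rw [tendsto_subtype_rng]
    refine ProbabilityMeasure.tendsto_iff_forall_integral_tendsto.2 fun g => ?_
    rw [tendsto_iff_dist_tendsto_zero]
    have h0 : Tendsto (fun p : Finset C(X, ℝ) × ℕ => 1 / ((p.2 : ℝ) + 1)) atTop (𝓝 0) := by
      rw [← prod_atTop_atTop_eq]
      exact tendsto_one_div_add_atTop_nhds_zero_nat.comp tendsto_snd
    refine squeeze_zero' (.of_forall fun _ => dist_nonneg) ?_ h0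
    filter_upwards [eventually_ge_atTop ({g.toContinuousMap}, 0)] with p hp
    rw [Real.dist_eq]
    exact (hclose p g.toContinuousMap (hp.1 (Finset.mem_singleton_self _))).trans
      (min_le_right _ _)
  obtain ⟨p, hp⟩ := (hlim.eventually (hU.mem_nhds hμU)).exists
  obtain ⟨k, hk, hk'⟩ := hrig p
  exact ⟨_, hp, k, hk, hk'.trans (min_le_left _ _)⟩

theorem continuous_integral_invariantMeasures (T : X → X) {g : X → ℝ} (hg : Continuous g) :
    Continuous fun μ : invariantMeasures T =>
      ∫ z, g z ∂((μ : ProbabilityMeasure X) : Measure X) :=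
  (ProbabilityMeasure.continuous_integral_continuousMap (⟨g, hg⟩ : C(X, ℝ))).comp
    continuous_subtype_val

/-- Strongly mixing measures whose correlations for `f` are uniformly small from time `N` on,
relative to the variance of `f`, form a nowhere dense set. -/
theorem isNowhereDense_uniformly_mixing (hT : Continuous T) (hsh : HasShadowing T) (f : C(X, ℝ))
    {c : ℝ} (hc : 0 < c) (N : ℕ) :
    IsNowhereDense {μ : invariantMeasures T |
      IsStronglyMixing T ((μ : ProbabilityMeasure X) : Measure X) ∧
      2 * c ≤ ∫ z, f z * f z ∂((μ : ProbabilityMeasure X) : Measure X) -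
        (∫ z, f z ∂((μ : ProbabilityMeasure X) : Measure X)) ^ 2 ∧
      ∀ k, N ≤ k → ∫ z, f z * f (T^[k] z) ∂((μ : ProbabilityMeasure X) : Measure X) -
        (∫ z, f z ∂((μ : ProbabilityMeasure X) : Measure X)) ^ 2 ≤ c} := by
  set E := {μ : invariantMeasures T | _} with hE
  -- Dropping strong mixing from `E` leaves closed conditions, which therefore survive in `closure
  -- E`.
  let K : Set (invariantMeasures T) := {μ |
      2 * c ≤ ∫ z, f z * f z ∂((μ : ProbabilityMeasure X) : Measure X) -
        (∫ z, f z ∂((μ : ProbabilityMeasure X) : Measure X)) ^ 2} ∩ ⋂ k, ⋂ (_ : N ≤ k), {μ |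
      ∫ z, f z * f (T^[k] z) ∂((μ : ProbabilityMeasure X) : Measure X) -
        (∫ z, f z ∂((μ : ProbabilityMeasure X) : Measure X)) ^ 2 ≤ c}
  have hf1 := (continuous_integral_invariantMeasures T f.continuous).pow 2
  have hK : IsClosed K := by
    refine IsClosed.inter ?_ (isClosed_iInter fun k => isClosed_iInter fun _ => ?_)
    · exact isClosed_le continuous_const ((continuous_integral_invariantMeasures T
        (f.continuous.mul f.continuous)).sub hf1)
    · exact isClosed_le ((continuous_integral_invariantMeasures T
        (f.continuous.mul (f.continuous.comp (hT.iterate k)))).sub hf1) continuous_const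
  have hEK : closure E ⊆ K := closure_minimal (fun μ hμ => ⟨hμ.2.1, mem_iInter₂.2 hμ.2.2⟩) hK
  rw [IsNowhereDense, eq_empty_iff_forall_notMem]
  intro μ₀ hμ₀
  obtain ⟨μ, hμU, hμE⟩ := mem_closure_iff.1 (interior_subset hμ₀) _ isOpen_interior hμ₀
  -- Rigidity up to `c / 2` would give covariance at least `2c - c / 2 > c` at time `k`.
  obtain ⟨ν, hνU, k, hk, hrig⟩ := exists_almost_rigid_mem_of_isOpen hT hsh isOpen_interior hμU
    hμE.1 f (η := c / 2) (by positivity) N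
  obtain ⟨h1, h2⟩ := hEK (interior_subset hνU)
  have h3 := mem_iInter₂.1 h2 k hk
  rw [mem_ofPred_eq] at h1 h3
  have h4 := (abs_le.1 hrig).1
  linarith

end Shadowing

/-! ### Dirac measures. -/

section Dirac

variable {X : Type*} [MetricSpace X] [MeasurableSpace X] [BorelSpace X] {T : X → X}

/-- A transitive system with shadowing and more than one point has, for each fixed point, an
invariant measure giving no mass to it. -/
theorem exists_invariant_singleton_eq_zero [CompactSpace X] [Nontrivial X] (hT : Continuous T)
    (htr : IsTransitive T) (hsh : HasShadowing T) {p : X} (hp : T p = p) :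
    ∃ ν : ProbabilityMeasure X, ν ∈ invariantMeasures T ∧ (ν : Measure X) {p} = 0 := by
  obtain ⟨q, hq⟩ := exists_ne p
  have hd : 0 < dist p q := dist_pos.2 hq.symm
  set ε := dist p q / 4 with hε
  obtain ⟨δ, hδ, hclose⟩ := hsh.exists_closing (ε := ε) (by positivity)
  have hr : 0 < min ε (δ / 2) := by positivity
  obtain ⟨n, hn, -, ⟨u, hu, rfl⟩, hu'⟩ := htr (Metric.ball q (min ε (δ / 2)))
    (Metric.ball q (min ε (δ / 2))) Metric.isOpen_ball ⟨q, Metric.mem_ball_self hr⟩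
    Metric.isOpen_ball ⟨q, Metric.mem_ball_self hr⟩
  rw [Metric.mem_ball, lt_min_iff] at hu hu'
  obtain ⟨y, hy⟩ := hclose u n hn (by linarith [dist_triangle_right (T^[n] u) u q])
  obtain ⟨ν, hinv, hν⟩ := exists_invariant_of_orbit hT y
  refine ⟨ν, hinv, ?_⟩
  -- Points reaching the `2ε`-ball about `q` within `n` steps: the whole orbit of `y` does, while
  -- the fixed point `p`, at distance `4ε` from `q`, never does.
  let C : Set X := ⋃ i ∈ Finset.range (n + 1), T^[i] ⁻¹' Metric.closedBall q (2 * ε)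
  have hC : IsClosed C := isClosed_biUnion_finset fun i _ =>
    Metric.isClosed_closedBall.preimage (hT.iterate i)
  have hCy : ∀ j, T^[j] y ∈ C := by
    intro j
    have hlt := Nat.mod_lt j hn
    -- This many further steps bring the time to a multiple of `n`, where the orbit is `ε`-close to
    -- `u`. The value `n` occurs, hence `n + 1` in the range.
    refine mem_biUnion (x := n - j % n) (Finset.mem_range.2 (by omega)) ?_
    have h0 : (n - j % n + j) % n = 0 := by
      have h1 := Nat.mod_add_div j n
      have h2 : n - j % n + j = n * (1 + j / n) := by rw [mul_add]; omega
      rw [h2, Nat.mul_mod_right]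
    have h1 := hy (n - j % n + j)
    rw [h0, Function.iterate_zero, id, Function.iterate_add_apply] at h1
    rw [mem_preimage, Metric.mem_closedBall]
    linarith [dist_triangle (T^[n - j % n] (T^[j] y)) u q]
  have hpC : p ∉ C := by
    intro h
    obtain ⟨i, -, hi⟩ := mem_iUnion₂.1 h
    rw [mem_preimage, Function.iterate_fixed hp, Metric.mem_closedBall] at hi
    linarith
  exact measure_mono_null (singleton_subset_iff.2 hpC)
    ((prob_compl_eq_zero_iff hC.measurableSet).2 (hν C hC hCy))

/-- An invariant Dirac measure sits at a fixed point `p`. Adding a small share of an invariant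
measure without mass at `p` gives nearby invariant measures whose mass at `p` is neither 0 nor 1. -/
theorem isNowhereDense_dirac [CompactSpace X] [Nontrivial X] (hT : Continuous T)
    (htr : IsTransitive T) (hsh : HasShadowing T) :
    IsNowhereDense {μ : invariantMeasures T | (μ : ProbabilityMeasure X) ∈ range diracProba} := by
  have hcl : IsClosed {μ : invariantMeasures T |
      (μ : ProbabilityMeasure X) ∈ range diracProba} :=
    (isCompact_range continuous_diracProba).isClosed.preimage continuous_subtype_val
  rw [hcl.isNowhereDense_iff, eq_empty_iff_forall_notMem]
  intro μ hμ
  obtain ⟨p, hp⟩ := interior_subset hμ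
  have hμp : ((μ : ProbabilityMeasure X) : Measure X) = Measure.dirac p := by rw [← hp]; rfl
  have hmp : MeasurePreserving T (Measure.dirac p) (Measure.dirac p) := hμp ▸ μ.2
  have hfix : T p = p := by
    have := hmp.measure_preimage (measurableSet_singleton p).nullMeasurableSet
    by_contra hne
    simp [Measure.dirac_apply' p (hT.measurable (measurableSet_singleton p)), hne] at this
  obtain ⟨ν, hinv, hν⟩ := exists_invariant_singleton_eq_zero hT htr hsh hfix
  -- The shift by 2 keeps both weights strictly between 0 and 1 for every `n`.
  let b : ℕ → NNReal := fun n => 1 / ((n : NNReal) + 2)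
  let a : ℕ → NNReal := fun n => ((n : NNReal) + 1) / ((n : NNReal) + 2)
  have hab : ∀ n, a n + b n = 1 := fun n => by
    simp only [a, b]; rw [← add_div, add_assoc, one_add_one_eq_two, div_self (by positivity)]
  let κ : ℕ → Measure X := fun n => a n • Measure.dirac p + b n • (ν : Measure X)
  have hκp : ∀ n, IsProbabilityMeasure (κ n) := fun n => ⟨by
    simp only [κ, Measure.add_apply, Measure.smul_apply, measure_univ, ENNReal.smul_def,
      smul_eq_mul, mul_one]
    exact_mod_cast hab n⟩
  have hκi : ∀ n, MeasurePreserving T (κ n) (κ n) := fun n =>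
    (hmp.smul_measure (a n)).add_measure (MeasurePreserving.smul_measure hinv (b n))
  let k : ℕ → invariantMeasures T := fun n => ⟨⟨κ n, hκp n⟩, hκi n⟩
  have hblim : Tendsto (fun n => (b n : ℝ)) atTop (𝓝 0) := by
    have := (tendsto_add_atTop_iff_nat 1).2 (tendsto_one_div_add_atTop_nhds_zero_nat (𝕜 := ℝ))
    refine this.congr fun n => ?_
    simp only [b]; push_cast; ring
  have halim : Tendsto (fun n => (a n : ℝ)) atTop (𝓝 1) := by
    have := hblim.const_sub 1
    rw [sub_zero] at this
    refine this.congr fun n => ?_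
    have : (a n : ℝ) + b n = 1 := by exact_mod_cast hab n
    linarith
  have hlim : Tendsto k atTop (𝓝 μ) := by
    rw [tendsto_subtype_rng]
    refine ProbabilityMeasure.tendsto_iff_forall_integral_tendsto.2 fun g => ?_
    have e : ∀ n, ∫ x, g x ∂(κ n) = a n * g p + b n * ∫ x, g x ∂(ν : Measure X) := fun n => by
      simp only [κ]
      rw [integral_add_measure ((integrable_of_continuous _ g.continuous).smul_measure_nnreal)
        ((integrable_of_continuous _ g.continuous).smul_measure_nnreal),
        integral_smul_nnreal_measure, integral_smul_nnreal_measure, integral_dirac]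
      rfl
    have h1 := (halim.mul_const (g p)).add (hblim.mul_const (∫ x, g x ∂(ν : Measure X)))
    rw [hμp, integral_dirac]
    rw [one_mul, zero_mul, add_zero] at h1
    exact h1.congr fun n => (e n).symm
  obtain ⟨n, hn⟩ := (hlim.eventually (isOpen_interior.mem_nhds hμ)).exists
  obtain ⟨q, hq⟩ := interior_subset hn
  have hκq : κ n = Measure.dirac q := congrArg (fun m : ProbabilityMeasure X => (m : Measure X)) hq.symm
  have h1 : κ n {p} = a n := by
    simp only [κ, Measure.add_apply, Measure.smul_apply, hν, mul_zero, add_zero,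
      Measure.dirac_apply_of_mem (mem_singleton p), ENNReal.smul_def, smul_eq_mul, mul_one]
  have ha0 : 0 < a n := by positivity
  have ha1 : a n < 1 := by
    rw [← hab n]; exact lt_add_of_pos_right _ (by positivity)
  rw [hκq, Measure.dirac_apply' q (measurableSet_singleton p)] at h1
  by_cases hqp : q = p
  · simp only [hqp, mem_singleton_iff, indicator_of_mem, Pi.one_apply] at h1
    exact ha1.ne (by exact_mod_cast h1.symm)
  · rw [indicator_of_notMem (by simpa using hqp)] at h1
    exact ha0.ne (by exact_mod_cast h1)

/-- A probability measure for which all distance functions to points of a dense sequence have zero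
variance is a Dirac measure. -/
theorem mem_range_diracProba_of_variance_eq_zero [CompactSpace X] {a : ℕ → X} (ha : DenseRange a)
    (μ : ProbabilityMeasure X)
    (h : ∀ i, ∫ z, dist z (a i) * dist z (a i) ∂(μ : Measure X) -
      (∫ z, dist z (a i) ∂(μ : Measure X)) ^ 2 ≤ 0) :
    μ ∈ range (diracProba : X → ProbabilityMeasure X) := by
  have hae : ∀ᵐ z ∂(μ : Measure X), ∀ i, dist z (a i) = ∫ z, dist z (a i) ∂(μ : Measure X) := by
    rw [ae_all_iff]
    intro i
    set c := ∫ z, dist z (a i) ∂(μ : Measure X) with hc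
    have hd : Continuous fun z : X => dist z (a i) := continuous_id.dist continuous_const
    have hint := integrable_of_continuous (μ : Measure X) ((hd.sub continuous_const).pow 2 :
      Continuous fun z => (dist z (a i) - c) ^ 2)
    have e : ∫ z, (dist z (a i) - c) ^ 2 ∂(μ : Measure X) =
        ∫ z, dist z (a i) * dist z (a i) ∂(μ : Measure X) - c ^ 2 := by
      have i1 : Integrable (fun z => dist z (a i) * dist z (a i)) (μ : Measure X) :=
        integrable_of_continuous _ (hd.mul hd)
      have i2 := (integrable_of_continuous (μ : Measure X) hd).const_mul (2 * c)
      have i3 : Integrable (fun z => dist z (a i) * dist z (a i) - 2 * c * dist z (a i))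
        (μ : Measure X) := i1.sub i2
      have : ∀ z, (dist z (a i) - c) ^ 2 =
          dist z (a i) * dist z (a i) - 2 * c * dist z (a i) + c ^ 2 := fun z => by ring
      simp_rw [this]
      rw [integral_add i3 (integrable_const _), integral_sub i1 i2, integral_const_mul, ← hc]
      simp only [integral_const, probReal_univ, one_smul]
      ring
    have hzero : ∫ z, (dist z (a i) - c) ^ 2 ∂(μ : Measure X) = 0 :=
      le_antisymm (e ▸ h i) (integral_nonneg fun z => sq_nonneg _)
    filter_upwards [(integral_eq_zero_iff_of_nonneg (fun z => sq_nonneg _) hint).1 hzero] with z hz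
    exact sub_eq_zero.1 (pow_eq_zero_iff two_ne_zero |>.1 hz)
  obtain ⟨z₀, hz₀⟩ := hae.exists
  have hz : ∀ᵐ z ∂(μ : Measure X), z = z₀ := by
    filter_upwards [hae] with z hz
    -- Almost every `z` has the same distances as `z₀` to a dense set, hence to every point;
    -- evaluate at `z₀`.
    have := ha.equalizer (g := fun w => dist z w) (h := fun w => dist z₀ w)
      (continuous_const.dist continuous_id) (continuous_const.dist continuous_id)
      (funext fun i => (hz i).trans (hz₀ i).symm)
    have h1 := congrFun this z₀
    simp only [dist_self] at h1
    exact dist_eq_zero.1 h1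
  refine ⟨z₀, ?_⟩
  refine ProbabilityMeasure.toMeasure_injective (Measure.ext fun s hs => ?_)
  rw [diracProba_toMeasure_apply' _ hs]
  by_cases hzs : z₀ ∈ s
  · rw [indicator_of_mem hzs, Pi.one_apply]
    refine ((prob_compl_eq_zero_iff hs).1 ?_).symm
    refine measure_mono_null (t := {z | z ≠ z₀}) ?_ hz
    rintro z h1 rfl
    exact h1 hzs
  · rw [indicator_of_notMem hzs]
    refine (measure_mono_null (t := {z | z ≠ z₀}) ?_ hz).symm
    rintro z h1 rfl
    exact hzs h1

end Dirac

end TopDyn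

/-! ### The countable cover. -/

theorem mainTheorem9 {X : Type*} [MetricSpace X] [CompactSpace X] [Nontrivial X]
    [MeasurableSpace X] [BorelSpace X] (T : X → X) (hT : Continuous T)
    (htrans : TopDyn.IsTransitive T) (hshadow : TopDyn.HasShadowing T) :
    IsMeagre {μ : TopDyn.invariantMeasures T |
      TopDyn.IsStronglyMixing T ((μ : ProbabilityMeasure X) : Measure X)} := by
  let a : ℕ → X := TopologicalSpace.denseSeq X
  let f : ℕ → C(X, ℝ) := fun i => ⟨fun z => dist z (a i), continuous_id.dist continuous_const⟩
  refine IsMeagre.mono ?_ ((TopDyn.isNowhereDense_dirac hT htrans hshadow).isMeagre.union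
    (isMeagre_iUnion fun i : ℕ => isMeagre_iUnion fun m : ℕ => isMeagre_iUnion fun N : ℕ =>
      (TopDyn.isNowhereDense_uniformly_mixing hT hshadow (f i)
        (c := 1 / ((m : ℝ) + 1)) (by positivity) N).isMeagre))
  intro μ hμ
  by_cases hvar : ∀ i, ∫ z, dist z (a i) * dist z (a i) ∂((μ : ProbabilityMeasure X) : Measure X) -
      (∫ z, dist z (a i) ∂((μ : ProbabilityMeasure X) : Measure X)) ^ 2 ≤ 0
  · exact Or.inl (TopDyn.mem_range_diracProba_of_variance_eq_zero
      (TopologicalSpace.denseRange_denseSeq X) _ hvar)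
  · right
    push Not at hvar
    obtain ⟨i, hi⟩ := hvar
    -- Half the variance, because the cover asks for variance at least `2c`.
    obtain ⟨m, hm⟩ := exists_nat_one_div_lt (half_pos hi)
    have hlim := (TopDyn.IsStronglyMixing.tendsto_integral_of_continuous hμ
      (f i).continuous).sub_const
        ((∫ z, f i z ∂((μ : ProbabilityMeasure X) : Measure X)) ^ 2)
    rw [sub_self] at hlim
    obtain ⟨N, hN⟩ := eventually_atTop.1
      (hlim.eventually_le_const (show (0 : ℝ) < 1 / ((m : ℝ) + 1) by positivity))
    simp only [mem_iUnion]
    refine ⟨i, m, N, hμ, ?_, hN⟩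
    change _ ≤ ∫ z, dist z (a i) * dist z (a i) ∂((μ : ProbabilityMeasure X) : Measure X) -
      (∫ z, dist z (a i) ∂((μ : ProbabilityMeasure X) : Measure X)) ^ 2
    linarith
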